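/- All posets are finite, and $\dim(P)$ denotes the order dimension of $P$ (the least number of linear extensions of $P$ whose intersection is $P$). For $d\ge 2$ the standard example $S_d$ is the poset with minimal elements $a_1,\dots,a_d$ and maximal elements $b_1,\dots,b_d$ in which $a_i<b_j$ if and only if $i\ne j$, with no other strict comparabilities; the same definition is used for $d\in\{0,1\}$. A poset $P$ contains $S_d$ if $P$ has a subposet isomorphic to $S_d$. (1) There are an absolute constant $C>0$ and an integer $c_0$ such that the following holds. Let $f$ be any integer-valued function such that for every integer $c\ge 1$ and all sufficiently large $n$ (depending on $f$ and $c$; in particular, it is enough that this holds for all $n>10f(c)$), every poset $P$ with $|P|\le 2n+1$ and $\dim(P)\ge n-c$ contains a standard example $S_d$ with $d\ge 2$ and $d\ge n-f(c)$. Then $f(c)\ge C\,c^{4/3}$ for all $c\ge c_0$. In particular, $f(c)=\Omega(c^{4/3})$. (2) Let $q$ be the order of a finite projective plane, let $m\ge 0$ be an integer, and put $n=m+(q^2+q+1)$. Let $Q$ be the poset whose lower elements are the points of the plane together with $a_1,\dots,a_m$, whose upper elements are the lines of the plane together with $b_1,\dots,b_m$, and whose only strict comparabilities are: $x<y$ for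 a point $x$ and a line $y$ with $x$ not on $y$; $a_i<b_j$ for $i\neq j$; $x<b_j$ for every point $x$ and every $j$; and $a_i<y$ for every $i$ and every line $y$. Then $|Q|=2n$, $\dim(Q)\ge n-q^{3/2}$, and $Q$ does not contain a standard example $S_d$ for any integer $d\ge m+q^{3/2}+2$. -/

import Mathlib

open Filter

/-- `r` (read as a reflexive order relation) is a linear extension of the poset `P`. -/
structure IsLinearExtension {P : Type*} [PartialOrder P] (r : P → P → Prop) : Prop where
  refl : ∀ x, r x x
  trans : ∀ x y z, r x y → r y z → r x z
  antisymm : ∀ x y, r x y → r y x → x = y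
  total : ∀ x y, r x y ∨ r y x
  extends_le : ∀ x y, x ≤ y → r x y

/-- `L` is a realizer of `P`: each `L i` is a linear extension of `P`, and `x < y` in `P` if and
only if `x < y` in every `L i`. -/
def IsRealizer {P : Type*} [PartialOrder P] {d : ℕ} (L : Fin d → P → P → Prop) : Prop :=
  (∀ i, IsLinearExtension (L i)) ∧ ∀ x y : P, x < y ↔ ∀ i, L i x y ∧ x ≠ y

/-- The dimension of a finite poset: the least `d` such that there is a realizer of size `d`.
The empty family is never a realizer of a nonempty poset (take `x = y`), so that the dimension of
a nonempty finite poset is positive (see `posetDim_pos_of_isRealizer`), while the dimension of the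
empty poset is `0`. -/
noncomputable def posetDim (P : Type*) [PartialOrder P] : ℕ :=
  sInf {d : ℕ | ∃ L : Fin d → P → P → Prop, IsRealizer L}

theorem posetDim_pos_of_isRealizer {P : Type*} [PartialOrder P] [Nonempty P] {d : ℕ}
    {L : Fin d → P → P → Prop} (hL : IsRealizer L) : 0 < posetDim P := by
  rw [Nat.pos_iff_ne_zero]
  intro h
  have hne : {d : ℕ | ∃ L : Fin d → P → P → Prop, IsRealizer L}.Nonempty := ⟨d, L, hL⟩
  have h0 : (0 : ℕ) ∈ {d : ℕ | ∃ L : Fin d → P → P → Prop, IsRealizer L} := by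
    have := Nat.sInf_mem hne
    rwa [show sInf {d : ℕ | ∃ L : Fin d → P → P → Prop, IsRealizer L} = 0 from h] at this
  obtain ⟨L, hL⟩ := h0
  obtain ⟨x⟩ := (inferInstance : Nonempty P)
  exact lt_irrefl x ((hL.2 x x).2 fun i => i.elim0)

/-- The ground set of the poset with lower elements `bot x` for `x : X`, upper elements `top y` for
`y : Y`, in which the only strict comparabilities are `bot x < top y` when `R x y`. -/
inductive BipartitePoset {X Y : Type*} (R : X → Y → Prop) where
  | bot (x : X) : BipartitePoset R
  | top (y : Y) : BipartitePoset R

namespace BipartitePoset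

/-- The order relation of the bipartite poset given by `R`. -/
inductive Le {X Y : Type*} (R : X → Y → Prop) : BipartitePoset R → BipartitePoset R → Prop where
  | refl (z : BipartitePoset R) : Le R z z
  | bot_top (x : X) (y : Y) (h : R x y) : Le R (bot x) (top y)

instance {X Y : Type*} (R : X → Y → Prop) : PartialOrder (BipartitePoset R) where
  le := Le R
  le_refl := Le.refl
  le_trans := by
    intro a b c h1 h2
    cases h1 with
    | refl => exact h2
    | bot_top x y h =>
      cases h2 with
      | refl => exact Le.bot_top x y h
  le_antisymm := by
    intro a b h1 h2
    cases h1 with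
    | refl => rfl
    | bot_top x y h => cases h2

end BipartitePoset

/-- The standard example `S_d`: lower elements `a_i`, upper elements `b_j`, `i, j : Fin d`, with
`a_i < b_j` if and only if `i ≠ j`. -/
abbrev StandardExample (d : ℕ) : Type :=
  BipartitePoset (fun i j : Fin d => i ≠ j)

/-- `P` contains (a subposet isomorphic to) the standard example `S_d`. -/
def ContainsStandardExample (P : Type*) [PartialOrder P] (d : ℕ) : Prop :=
  Nonempty (StandardExample d ↪o P)

/-- The comparabilities between lower and upper elements in the join of the point-line
non-incidence poset of a plane (`Pt` the points, `Ln` the lines) with the standard example `S_m`: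
a point is below a line when it is not on it, `a_i` is below `b_j` when `i ≠ j`, every point is
below every `b_j`, and every `a_i` is below every line. -/
def planeJoinRel (Pt Ln : Type*) [Membership Pt Ln] (m : ℕ) : Pt ⊕ Fin m → Ln ⊕ Fin m → Prop
  | Sum.inl p, Sum.inl l => p ∉ l
  | Sum.inl _, Sum.inr _ => True
  | Sum.inr _, Sum.inl _ => True
  | Sum.inr i, Sum.inr j => i ≠ j

/-- The poset obtained by joining the point-line non-incidence poset of a plane with `S_m`. -/
abbrev PlaneJoin (Pt Ln : Type*) [Membership Pt Ln] (m : ℕ) : Type _ :=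
  BipartitePoset (planeJoinRel Pt Ln m)

/-- `f` is admissible: for every integer `c ≥ 1` and all sufficiently large `n`, every poset `P`
with `|P| ≤ 2n + 1` and `dim P ≥ n - c` contains a standard example `S_d` (`d ≥ 2`) with
`d ≥ n - f c`. In particular this holds if it holds for all `n > 10 * f c`. -/
def ForcesStandardExamples (f : ℕ → ℤ) : Prop :=
  ∀ c : ℕ, 1 ≤ c → ∀ᶠ n : ℕ in atTop,
    ∀ (P : Type) [PartialOrder P] [Finite P],
      Nat.card P ≤ 2 * n + 1 → (n : ℤ) - (c : ℤ) ≤ (posetDim P : ℤ) →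
        ∃ d : ℕ, 2 ≤ d ∧ (n : ℤ) - f c ≤ (d : ℤ) ∧ ContainsStandardExample P d

theorem forcesStandardExamples_of_gt_ten_mul {f : ℕ → ℤ}
    (hf : ∀ c : ℕ, 1 ≤ c → ∀ n : ℕ, 10 * f c < (n : ℤ) →
      ∀ (P : Type) [PartialOrder P] [Finite P],
        Nat.card P ≤ 2 * n + 1 → (n : ℤ) - (c : ℤ) ≤ (posetDim P : ℤ) →
          ∃ d : ℕ, 2 ≤ d ∧ (n : ℤ) - f c ≤ (d : ℤ) ∧ ContainsStandardExample P d) :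
    ForcesStandardExamples f := by
  intro c hc
  filter_upwards [eventually_gt_atTop (10 * f c).toNat] with n hn
  exact hf c hc n (by omega)

/-! Part (1) follows from (2) by choosing a prime `q` of order `c ^ (2 / 3)` and letting `m` be as
large as needed: `m` adds equally to `n`, to the dimension bound and to the standard examples, so a
gap between `q ^ (3 / 2)` and about `q ^ 2` persists for arbitrarily large `n`. Part (2) rests on
the expander mixing property of the incidence graph (`incidence_mixing`). The incidences reversed by
one linear extension are all covered by one point and one line, so `k` extensions reversing all
incidences leave, after deleting `k` points and `k` lines, no incidence at all; mixing forces `k` to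
be nearly everything. A standard example inside the plane part is an induced matching of incidences,
and mixing bounds its size by `q ^ (3 / 2) + 1`. -/

open Configuration

/-! ### Existence of realizers -/

/-- Szpilrajn's theorem with a prescribed reversed pair. -/
theorem exists_isLinearExtension_not_of_not_le {P : Type*} [PartialOrder P] {x y : P}
    (h : ¬ x ≤ y) : ∃ r : P → P → Prop, IsLinearExtension r ∧ ¬ r x y := by
  -- The least order that extends `≤` and puts `y` below `x`.
  have hpo : IsPartialOrder P (fun a b => a ≤ b ∨ (a ≤ y ∧ x ≤ b)) :=
    { refl := fun a => Or.inl le_rfl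
      trans := by
        rintro a b c (h1 | ⟨h1, h2⟩) (h3 | ⟨h3, h4⟩)
        · exact Or.inl (h1.trans h3)
        · exact Or.inr ⟨h1.trans h3, h4⟩
        · exact Or.inr ⟨h1, h2.trans h3⟩
        · exact Or.inr ⟨h1, h4⟩
      antisymm := by
        rintro a b (h1 | ⟨h1, h2⟩) (h3 | ⟨h3, h4⟩)
        · exact le_antisymm h1 h3
        · exact absurd (h4.trans (h1.trans h3)) h
        · exact absurd (h2.trans (h3.trans h1)) h
        · exact absurd (h2.trans h3) h }
  obtain ⟨s, hs, hrs⟩ := extend_partialOrder (fun a b : P => a ≤ b ∨ (a ≤ y ∧ x ≤ b))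
  refine ⟨s, ⟨fun a => hs.refl a, fun a b c => hs.trans a b c, fun a b => hs.antisymm a b,
    fun a b => hs.total a b, fun a b hab => hrs a b (Or.inl hab)⟩, fun hxy => h ?_⟩
  exact (hs.antisymm x y hxy (hrs y x (Or.inr ⟨le_rfl, le_rfl⟩))).le

theorem exists_isRealizer (P : Type*) [PartialOrder P] [Finite P] [Nonempty P] :
    ∃ (d : ℕ) (L : Fin d → P → P → Prop), IsRealizer L := by
  have key : ∀ z : P × P, ∃ r : P → P → Prop,
      IsLinearExtension r ∧ (r z.1 z.2 → z.1 ≤ z.2) := by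
    rintro ⟨x, y⟩
    by_cases hxy : x ≤ y
    · by_cases hyx : ∃ a b : P, ¬ a ≤ b
      · obtain ⟨a, b, hab⟩ := hyx
        obtain ⟨r, hr, -⟩ := exists_isLinearExtension_not_of_not_le hab
        exact ⟨r, hr, fun _ => hxy⟩
      · push Not at hyx
        exact ⟨(· ≤ ·), ⟨le_refl, fun _ _ _ => le_trans, fun _ _ => le_antisymm,
          fun a b => Or.inl (hyx a b), fun _ _ => id⟩, id⟩
    · obtain ⟨r, hr, hn⟩ := exists_isLinearExtension_not_of_not_le hxy
      exact ⟨r, hr, fun h => absurd h hn⟩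
  choose r hr hrz using key
  let e := Finite.equivFin (P × P)
  refine ⟨_, fun i => r (e.symm i), fun i => hr _, fun x y => ⟨fun h i =>
    ⟨(hr _).extends_le _ _ h.le, h.ne⟩, fun h => ?_⟩⟩
  have h1 := h (e (x, y))
  simp only [Equiv.symm_apply_apply] at h1
  exact lt_of_le_of_ne (hrz (x, y) h1.1) h1.2

/-- A lower bound on the size of all realizers is a lower bound on the dimension. -/
theorem le_posetDim {P : Type*} [PartialOrder P] [Finite P] [Nonempty P] {a : ℝ}
    (h : ∀ (d : ℕ) (L : Fin d → P → P → Prop), IsRealizer L → a ≤ d) :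
    a ≤ (posetDim P : ℝ) := by
  -- `sInf ∅ = 0`, so the bound needs some realizer to exist.
  obtain ⟨d, L, hL⟩ := exists_isRealizer P
  obtain ⟨L', hL'⟩ := Nat.sInf_mem (s := {d : ℕ | ∃ L : Fin d → P → P → Prop, IsRealizer L})
    ⟨d, L, hL⟩
  exact h _ L' hL'

/-! ### Reversed pairs and standard examples in bipartite posets -/

namespace BipartitePoset

variable {X Y : Type*} {R : X → Y → Prop}

/-- The elements of a bipartite poset are its lower and its upper elements. -/
def equivSum (R : X → Y → Prop) : BipartitePoset R ≃ X ⊕ Y where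
  toFun
    | bot x => Sum.inl x
    | top y => Sum.inr y
  invFun
    | Sum.inl x => bot x
    | Sum.inr y => top y
  left_inv := by rintro (x | y) <;> rfl
  right_inv := by rintro (x | y) <;> rfl

instance [Finite X] [Finite Y] : Finite (BipartitePoset R) :=
  Finite.of_equiv _ (equivSum R).symm

theorem card_eq [Finite X] [Finite Y] :
    Nat.card (BipartitePoset R) = Nat.card X + Nat.card Y := by
  rw [Nat.card_congr (equivSum R), Nat.card_sum]

theorem bot_le_top_iff {x : X} {y : Y} : (bot x : BipartitePoset R) ≤ top y ↔ R x y := by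
  constructor
  · intro h
    cases h with
    | bot_top _ _ h => exact h
  · exact fun h => Le.bot_top x y h

theorem exists_bot_top_of_lt {u v : BipartitePoset R} (h : u < v) :
    ∃ x y, u = bot x ∧ v = top y := by
  have hle : Le R u v := h.le
  cases hle with
  | refl => exact absurd h (lt_irrefl _)
  | bot_top x y _ => exact ⟨x, y, rfl, rfl⟩

/-- Every incomparable pair of a lower and an upper element is reversed in some member of a
realizer. -/
theorem exists_reversed {d : ℕ} {L : Fin d → BipartitePoset R → BipartitePoset R → Prop}
    (hL : IsRealizer L) {x : X} {y : Y} (h : ¬ R x y) : ∃ i, L i (top y) (bot x) := by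
  by_contra hn
  push Not at hn
  have hlt : (bot x : BipartitePoset R) < top y :=
    (hL.2 _ _).2 fun i => ⟨((hL.1 i).total _ _).resolve_right (hn i), by simp⟩
  exact h (bot_le_top_iff.1 hlt.le)

/-- Two pairs reversed in the same linear extension do not form an alternating cycle. -/
theorem not_and_of_reversed {L : BipartitePoset R → BipartitePoset R → Prop}
    (hL : IsLinearExtension L) {x x' : X} {y y' : Y} (h : L (top y) (bot x))
    (h' : L (top y') (bot x')) : ¬ (R x y' ∧ R x' y) := by
  rintro ⟨h1, h2⟩
  have h3 : L (bot x) (top y) := hL.trans _ _ _ (hL.extends_le _ _ (bot_le_top_iff.2 h1))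
    (hL.trans _ _ _ h' (hL.extends_le _ _ (bot_le_top_iff.2 h2)))
  exact absurd (hL.antisymm _ _ h h3) (by simp)

/-- A copy of a standard example consists of pairs `(x i, y i)` of a lower and an upper element
such that `x i` is below `y j` exactly when `i ≠ j`. -/
theorem exists_pairs_of_containsStandardExample {d : ℕ} (hd : 2 ≤ d)
    (h : ContainsStandardExample (BipartitePoset R) d) :
    ∃ (x : Fin d → X) (y : Fin d → Y), ∀ i j, R (x i) (y j) ↔ i ≠ j := by
  obtain ⟨f⟩ := h
  have hlt : ∀ i j : Fin d, i ≠ j → f (bot i) < f (top j) := fun i j hij =>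
    f.lt_iff_lt.2 (lt_of_le_of_ne (bot_le_top_iff.2 hij) (by simp))
  -- With two indices every element has a strict comparability, which fixes its level in the image.
  have : Nontrivial (Fin d) := Fin.nontrivial_iff_two_le.2 hd
  have hx : ∀ i, ∃ x, f (bot i) = bot x := fun i => by
    obtain ⟨j, hj⟩ := exists_ne i
    obtain ⟨x, _, hx, _⟩ := exists_bot_top_of_lt (hlt i j hj.symm)
    exact ⟨x, hx⟩
  have hy : ∀ j, ∃ y, f (top j) = top y := fun j => by
    obtain ⟨i, hi⟩ := exists_ne j
    obtain ⟨_, y, _, hy⟩ := exists_bot_top_of_lt (hlt i j hi)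
    exact ⟨y, hy⟩
  choose x hx using hx
  choose y hy using hy
  refine ⟨x, y, fun i j => ?_⟩
  rw [← bot_le_top_iff (R := R), ← hx, ← hy, f.le_iff_le, bot_le_top_iff]

end BipartitePoset

/-! ### Expander mixing in a projective plane -/

section Mixing

variable {Pt Ln : Type*} [Membership Pt Ln] [ProjectivePlane Pt Ln] [Fintype Pt]

open Classical in
theorem card_filter_mem_eq [Finite Ln] (l : Ln) :
    (Finset.univ.filter fun p : Pt => p ∈ l).card = ProjectivePlane.order Pt Ln + 1 := by
  rw [← ProjectivePlane.pointCount_eq Pt l, pointCount, Nat.card_eq_fintype_card,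
    Fintype.card_subtype]

open Classical in
theorem card_filter_mem_and_mem_eq_one {l l' : Ln} (h : l ≠ l') :
    (Finset.univ.filter fun p : Pt => p ∈ l ∧ p ∈ l').card = 1 := by
  obtain ⟨p, hp, hu⟩ := HasPoints.existsUnique_point Pt Ln l l' h
  exact Finset.card_eq_one.2 ⟨p, by ext x; simpa using ⟨fun hx => hu x hx, fun hx => hx ▸ hp⟩⟩

open Classical in
/-- The expander mixing lemma for the incidence graph of a projective plane. -/
theorem incidence_mixing [Fintype Ln] (A : Finset Pt) (B : Finset Ln) {q : ℕ} {N e : ℝ}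
    (hq : q = ProjectivePlane.order Pt Ln) (hN : N = (q : ℝ) ^ 2 + q + 1)
    (he : e = ∑ p ∈ A, ∑ l ∈ B, if p ∈ l then (1 : ℝ) else 0) :
    (N * e - A.card * B.card * (q + 1)) ^ 2 ≤
      q * A.card * B.card * (N - A.card) * (N - B.card) := by
  have hNpos : 0 < N := by rw [hN]; positivity
  have hcard : (Fintype.card Pt : ℝ) = N := by
    rw [ProjectivePlane.card_points Pt Ln, ← hq, hN]; push_cast; ring
  set a : ℝ := (A.card : ℝ) with ha
  set b : ℝ := (B.card : ℝ) with hb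
  let x : Pt → ℝ := fun p => ∑ l ∈ B, if p ∈ l then (1 : ℝ) else 0
  let t : Pt → ℝ := fun p => if p ∈ A then (1 : ℝ) else 0
  have hx1 : ∑ p, x p = b * (q + 1) := by
    simp only [x]
    rw [Finset.sum_comm]
    simp only [Finset.sum_boole, card_filter_mem_eq, ← hq]
    simp [← hb, mul_add]
  have hx2 : ∑ p, x p ^ 2 = b * (q + b) := by
    have h1 : ∀ p, x p ^ 2 = ∑ l ∈ B, ∑ l' ∈ B, if p ∈ l ∧ p ∈ l' then (1 : ℝ) else 0 := by
      intro p
      simp only [x, pow_two, Finset.sum_mul_sum]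
      refine Finset.sum_congr rfl fun l _ => Finset.sum_congr rfl fun l' _ => ?_
      by_cases h : p ∈ l <;> by_cases h' : p ∈ l' <;> simp [h, h']
    have h2 : ∀ l l' : Ln, ∑ p : Pt, (if p ∈ l ∧ p ∈ l' then (1 : ℝ) else 0) =
        1 + if l = l' then (q : ℝ) else 0 := by
      intro l l'
      rw [Finset.sum_boole]
      by_cases h : l = l'
      · subst h
        simp [card_filter_mem_eq, ← hq, add_comm]
      · simp [card_filter_mem_and_mem_eq_one h, h]
    simp only [h1]
    rw [Finset.sum_comm]
    have h3 : ∀ l ∈ B, ∑ p : Pt, ∑ l' ∈ B, (if p ∈ l ∧ p ∈ l' then (1 : ℝ) else 0) = b + q := by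
      intro l hl
      rw [Finset.sum_comm]
      simp [h2, Finset.sum_add_distrib, hl, hb]
    rw [Finset.sum_congr rfl h3]
    simp [← hb, mul_add, add_comm]
  have ht1 : ∑ p, t p = a := by simp [t, ha]
  have ht2 : ∑ p, t p ^ 2 = a := by simp [t, ha]
  have htx : ∑ p, t p * x p = e := by simp [t, x, he]
  -- Cauchy–Schwarz for the indicator of `A` and the degrees into `B`, both scaled by `N` and
  -- centred to sum zero. The second moment of the degrees is known because two lines meet in
  -- exactly one point.
  have hcs := Finset.sum_mul_sq_le_sq_mul_sq Finset.univ (fun p => N * t p - a)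
    (fun p => N * x p - b * (q + 1))
  have e1 : ∑ p, (N * t p - a) * (N * x p - b * (q + 1)) =
      N * (N * e - a * b * (q + 1)) := by
    have : ∀ p, (N * t p - a) * (N * x p - b * (q + 1)) =
        N ^ 2 * (t p * x p) - N * b * (q + 1) * t p - a * N * x p + a * b * (q + 1) := by
      intro p; ring
    simp only [this, Finset.sum_add_distrib, Finset.sum_sub_distrib, ← Finset.mul_sum, htx, ht1,
      hx1, Finset.sum_const, Finset.card_univ, nsmul_eq_mul, hcard]
    ring
  have e2 : ∑ p, (N * t p - a) ^ 2 = N * (a * (N - a)) := by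
    have : ∀ p, (N * t p - a) ^ 2 = N ^ 2 * t p ^ 2 - 2 * N * a * t p + a ^ 2 := by
      intro p; ring
    simp only [this, Finset.sum_add_distrib, Finset.sum_sub_distrib, ← Finset.mul_sum, ht1, ht2,
      Finset.sum_const, Finset.card_univ, nsmul_eq_mul, hcard]
    ring
  have e3 : ∑ p, (N * x p - b * (q + 1)) ^ 2 = N * (q * b * (N - b)) := by
    have : ∀ p, (N * x p - b * (q + 1)) ^ 2 =
        N ^ 2 * x p ^ 2 - 2 * N * b * (q + 1) * x p + (b * (q + 1)) ^ 2 := by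
      intro p; ring
    simp only [this, Finset.sum_add_distrib, Finset.sum_sub_distrib, ← Finset.mul_sum, hx1, hx2,
      Finset.sum_const, Finset.card_univ, nsmul_eq_mul, hcard]
    rw [hN]
    ring
  rw [e1, e2, e3, mul_pow] at hcs
  have hN2 : 0 < N ^ 2 := by positivity
  refine le_of_mul_le_mul_left (hcs.trans (le_of_eq ?_)) hN2
  ring

end Mixing

theorem rpow_three_halves_eq (q : ℕ) : (q : ℝ) ^ (3 / 2 : ℝ) = q * √q := by
  rw [show (3 / 2 : ℝ) = 1 + 1 / 2 by norm_num, Real.rpow_add' (by positivity) (by norm_num),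
    Real.rpow_one, ← Real.sqrt_eq_rpow]

/-! ### Incidence-free sets and induced matchings -/

section Plane

variable {Pt Ln : Type*} [Membership Pt Ln] [ProjectivePlane Pt Ln]

/-- Sets of points and of lines without incidences, each missing at most `k` elements, are small. -/
theorem card_sub_le_of_no_incidence [Fintype Pt] [Fintype Ln] (A : Finset Pt) (B : Finset Ln)
    (h : ∀ p ∈ A, ∀ l ∈ B, p ∉ l) {q k : ℕ} (hq : q = ProjectivePlane.order Pt Ln)
    (hA : q ^ 2 + q + 1 ≤ A.card + k) (hB : q ^ 2 + q + 1 ≤ B.card + k) :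
    ((q : ℝ) ^ 2 + q + 1) - q * √q ≤ k := by
  classical
  have hq1 : (1 : ℝ) ≤ q := by
    have := ProjectivePlane.one_lt_order Pt Ln
    exact_mod_cast (hq ▸ this).le
  set N : ℝ := (q : ℝ) ^ 2 + q + 1 with hN
  have hmix := incidence_mixing A B hq hN rfl
  rw [Finset.sum_eq_zero fun p hp => Finset.sum_eq_zero fun l hl => if_neg (h p hp l hl)] at hmix
  set r : ℝ := √q with hr
  have hrr : r ^ 2 = q := Real.sq_sqrt (by positivity)
  have hr1 : 1 ≤ r := Real.one_le_sqrt.2 hq1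
  by_contra hlt
  push Not at hlt
  have hA' : N ≤ A.card + k := by rw [hN]; exact_mod_cast hA
  have hB' : N ≤ B.card + k := by rw [hN]; exact_mod_cast hB
  have hs : q * r < N - k := by linarith
  have hk0 : (0 : ℝ) ≤ k := by positivity
  have hqr : 0 < (q : ℝ) * r := by positivity
  -- Under the contrary assumption both sets are nonempty, so their sizes cancel from the mixing
  -- inequality.
  have hpos : (0 : ℝ) < A.card * B.card := mul_pos (by linarith) (by linarith)
  have h1 : (A.card * B.card * ((q : ℝ) + 1) ^ 2 : ℝ) ≤ q * (N - A.card) * (N - B.card) := by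
    refine le_of_mul_le_mul_left (le_of_eq_of_le ?_ (hmix.trans (le_of_eq ?_))) hpos <;> ring
  have hcA : (A.card : ℝ) ≤ N := by
    rw [hN]
    have := Finset.card_le_univ A
    rw [ProjectivePlane.card_points Pt Ln, ← hq] at this
    exact_mod_cast this
  have h2 : (N - A.card) * (N - B.card) ≤ (k : ℝ) * k :=
    (mul_le_mul_of_nonneg_left (by linarith) (by linarith)).trans
      (mul_le_mul_of_nonneg_right (by linarith) hk0)
  have h3 : (N - k) * (N - k) ≤ (A.card * B.card : ℝ) :=
    mul_le_mul (by linarith) (by linarith) (by linarith) (by linarith)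
  have h4 : ((N - k) * (q + 1)) ^ 2 ≤ (r * k) ^ 2 := by
    calc ((N - k) * (q + 1)) ^ 2 = ((N - k) * (N - k)) * ((q : ℝ) + 1) ^ 2 := by ring
      _ ≤ A.card * B.card * ((q : ℝ) + 1) ^ 2 := mul_le_mul_of_nonneg_right h3 (by positivity)
      _ ≤ q * ((N - A.card) * (N - B.card)) := h1.trans (le_of_eq (by ring))
      _ ≤ q * (k * k) := mul_le_mul_of_nonneg_left h2 (by positivity)
      _ = (r * k) ^ 2 := by rw [mul_pow, hrr]; ring
  have h5 : (N - k) * (q + 1) ≤ r * k := le_of_sq_le_sq h4 (by positivity)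
  -- Adding `r * (N - k)` to both sides of `h5` lets the factor `q + 1 + r` of `N` cancel. The
  -- outcome `q * r + r - q` is at most `q * r` since `r ≤ q`.
  have h6 : (N - k) * (q + 1 + r) ≤ (r * (q + 1 - r)) * (q + 1 + r) := by
    have : N = (q + 1 - r) * (q + 1 + r) := by rw [hN]; linear_combination hrr
    have h7 : (N - k) * (q + 1 + r) ≤ r * N := by linarith
    exact h7.trans (le_of_eq (by rw [this]; ring))
  have h8 : N - k ≤ r * (q + 1 - r) := le_of_mul_le_mul_right h6 (by positivity)
  nlinarith

/-- An induced matching in the incidence graph has at most `q ^ (3 / 2) + 1` edges. -/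
theorem card_le_of_induced_matching [Finite Pt] [Finite Ln] {ι : Type*} [Fintype ι] (p : ι → Pt)
    (l : ι → Ln) (h : ∀ i j, p i ∈ l j ↔ i = j) {q : ℕ} (hq : q = ProjectivePlane.order Pt Ln) :
    (Fintype.card ι : ℝ) ≤ q * √q + 1 := by
  classical
  have := Fintype.ofFinite Pt
  have := Fintype.ofFinite Ln
  have hp : Function.Injective p := fun i j hij => (h i j).1 (hij ▸ (h j j).2 rfl)
  have hl : Function.Injective l := fun i j hij => (h i j).1 (hij ▸ (h i i).2 rfl)
  set N : ℝ := (q : ℝ) ^ 2 + q + 1 with hN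
  have hmix := incidence_mixing (Finset.univ.image p) (Finset.univ.image l) hq hN rfl
  rw [Finset.sum_image hp.injOn, Finset.card_image_of_injective _ hp,
    Finset.card_image_of_injective _ hl, Finset.card_univ] at hmix
  have hsum : ∑ i, ∑ m ∈ Finset.univ.image l, (if p i ∈ m then (1 : ℝ) else 0) =
      Fintype.card ι := by
    simp [Finset.sum_image hl.injOn, h]
  rw [hsum] at hmix
  have hcard : (Fintype.card ι : ℝ) ≤ N := by
    rw [hN]
    have := Fintype.card_le_of_injective p hp
    rw [ProjectivePlane.card_points Pt Ln, ← hq] at this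
    exact_mod_cast this
  set s : ℝ := (Fintype.card ι : ℝ) with hs
  set r : ℝ := √q with hr
  have hrr : r ^ 2 = q := Real.sq_sqrt (by positivity)
  have hr0 : 0 ≤ r := Real.sqrt_nonneg _
  have hq0 : (0 : ℝ) ≤ q := by positivity
  have hs0 : 0 ≤ s := by positivity
  rcases hs0.eq_or_lt with h0 | hspos
  · rw [← h0]; positivity
  have h1 : (s * (s * (q + 1) - N)) ^ 2 ≤ (s * (r * (N - s))) ^ 2 := by
    calc (s * (s * (q + 1) - N)) ^ 2 = (N * s - s * s * (q + 1)) ^ 2 := by ring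
      _ ≤ q * s * s * (N - s) * (N - s) := hmix
      _ = (s * (r * (N - s))) ^ 2 := by rw [← hrr]; ring
  have h2 : s * (s * (q + 1) - N) ≤ s * (r * (N - s)) :=
    le_of_sq_le_sq h1 (mul_nonneg hs0 (mul_nonneg hr0 (by linarith)))
  have h3 : s * (q + 1) - N ≤ r * (N - s) := le_of_mul_le_mul_left h2 hspos
  -- The same factorization of `N`; here `(1 + r) * (q + 1 - r)` equals `q * r + 1` exactly.
  have h4 : s * (q + 1 + r) ≤ ((1 + r) * (q + 1 - r)) * (q + 1 + r) := by
    have : N = (q + 1 - r) * (q + 1 + r) := by rw [hN]; linear_combination hrr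
    have h7 : s * (q + 1 + r) ≤ (1 + r) * N := by linarith
    exact h7.trans (le_of_eq (by rw [this]; ring))
  have h8 : s ≤ (1 + r) * (q + 1 - r) := le_of_mul_le_mul_right h4 (by positivity)
  nlinarith

/-! ### Dimension and standard examples of the join -/

open BipartitePoset

/-- All incidences reversed in a linear extension share a point or a line with a fixed flag. -/
theorem exists_flag_of_isLinearExtension [Finite Pt] [Finite Ln] [Nonempty Pt] [Nonempty Ln]
    {m : ℕ} {L : PlaneJoin Pt Ln m → PlaneJoin Pt Ln m → Prop} (hL : IsLinearExtension L) :
    ∃ (p₀ : Pt) (l₀ : Ln), ∀ (p : Pt) (l : Ln), p ∈ l →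
      L (top (Sum.inl l)) (bot (Sum.inl p)) → p = p₀ ∨ l = l₀ := by
  have hd : Directed L fun p : Pt => (bot (Sum.inl p) : PlaneJoin Pt Ln m) := fun x y => by
    rcases hL.total (bot (Sum.inl x)) (bot (Sum.inl y)) with h | h
    · exact ⟨y, h, hL.refl _⟩
    · exact ⟨x, hL.refl _, h⟩
  have hd' : Directed (fun x y => L y x)
      fun l : Ln => (top (Sum.inl l) : PlaneJoin Pt Ln m) := fun x y => by
    rcases hL.total (top (Sum.inl x)) (top (Sum.inl y)) with h | h
    · exact ⟨x, hL.refl _, h⟩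
    · exact ⟨y, h, hL.refl _⟩
  have : IsTrans _ L := ⟨hL.trans⟩
  have : IsTrans _ (fun x y => L y x) := ⟨fun x y z h h' => hL.trans _ _ _ h' h⟩
  -- `p₀` is the last point and `l₀` the first line in `L`. If `l` precedes `p`, then `l₀, l, p, p₀`
  -- occur in this order, so both lines contain both points.
  obtain ⟨p₀, hp₀⟩ := hd.finite_le id
  obtain ⟨l₀, hl₀⟩ := hd'.finite_le id
  have hinc : ∀ (p : Pt) (l : Ln), L (top (Sum.inl l)) (bot (Sum.inl p)) → p ∈ l := by
    intro p l h
    by_contra hn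
    exact not_and_of_reversed hL h h ⟨hn, hn⟩
  refine ⟨p₀, l₀, fun p l hpl h => ?_⟩
  have h1 := hL.trans _ _ _ h (hp₀ p)
  have h2 := hL.trans _ _ _ (hl₀ l) h
  have h3 := hL.trans _ _ _ (hl₀ l) h1
  exact Nondegenerate.eq_or_eq hpl (hinc _ _ h1) (hinc _ _ h2) (hinc _ _ h3)

/-- The `m` pairs of `S_m` need distinct extensions, and none of these reverses an incidence, as
that would close an alternating cycle. The remaining extensions must cover all incidences by one
point and one line each. -/
theorem le_of_isRealizer_planeJoin [Finite Pt] [Finite Ln] {q m d : ℕ}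
    (hq : q = ProjectivePlane.order Pt Ln)
    {L : Fin d → PlaneJoin Pt Ln m → PlaneJoin Pt Ln m → Prop} (hL : IsRealizer L) :
    (m : ℝ) + (q ^ 2 + q + 1) - q * √q ≤ d := by
  classical
  have := Fintype.ofFinite Pt
  have := Fintype.ofFinite Ln
  have hPt := ProjectivePlane.card_points Pt Ln
  have hLn := ProjectivePlane.card_lines Pt Ln
  rw [← hq] at hPt hLn
  have : Nonempty Pt := Fintype.card_pos_iff.1 (by omega)
  have : Nonempty Ln := Fintype.card_pos_iff.1 (by omega)
  choose p₀ l₀ hflag using fun i => exists_flag_of_isLinearExtension (hL.1 i)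
  have hg : ∀ k : Fin m, ∃ i, L i (top (Sum.inr k)) (bot (Sum.inr k)) := fun k =>
    exists_reversed hL fun h => h rfl
  choose g hg using hg
  have hginj : Function.Injective g := by
    intro k k' hk
    by_contra hne
    have hk' := hg k'
    rw [← hk] at hk'
    exact not_and_of_reversed (hL.1 (g k)) (hg k) hk' ⟨hne, Ne.symm hne⟩
  let K : Finset (Fin d) := Finset.univ.filter fun i =>
    ∃ (p : Pt) (l : Ln), L i (top (Sum.inl l)) (bot (Sum.inl p))
  have hdisj : Disjoint (Finset.univ.image g) K := by
    rw [Finset.disjoint_left]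
    intro i hi hiK
    obtain ⟨k, -, rfl⟩ := Finset.mem_image.1 hi
    obtain ⟨p, l, hpl⟩ := (Finset.mem_filter.1 hiK).2
    exact not_and_of_reversed (hL.1 (g k)) (hg k) hpl ⟨trivial, trivial⟩
  have hcard : m + K.card ≤ d := by
    have := Finset.card_le_univ (Finset.univ.image g ∪ K)
    rw [Finset.card_union_of_disjoint hdisj, Finset.card_image_of_injective _ hginj] at this
    simpa using this
  have hmain := card_sub_le_of_no_incidence (Finset.univ \ K.image p₀) (Finset.univ \ K.image l₀)
    (q := q) (k := K.card) ?_ hq ?_ ?_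
  · have : (m : ℝ) + K.card ≤ d := by exact_mod_cast hcard
    linarith
  · intro p hp l hl hpl
    obtain ⟨i, hi⟩ := exists_reversed (x := Sum.inl p) (y := Sum.inl l) hL (fun h => h hpl)
    have hiK : i ∈ K := Finset.mem_filter.2 ⟨Finset.mem_univ _, p, l, hi⟩
    rcases hflag i p l hpl hi with rfl | rfl
    · exact (Finset.mem_sdiff.1 hp).2 (Finset.mem_image_of_mem _ hiK)
    · exact (Finset.mem_sdiff.1 hl).2 (Finset.mem_image_of_mem _ hiK)
  · have h1 := Finset.le_card_sdiff (K.image p₀) Finset.univ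
    have h2 := Finset.card_image_le (s := K) (f := p₀)
    rw [Finset.card_univ, hPt] at h1
    omega
  · have h1 := Finset.le_card_sdiff (K.image l₀) Finset.univ
    have h2 := Finset.card_image_le (s := K) (f := l₀)
    rw [Finset.card_univ, hLn] at h1
    omega

theorem le_posetDim_planeJoin [Finite Pt] [Finite Ln] {q m : ℕ}
    (hq : q = ProjectivePlane.order Pt Ln) :
    (m : ℝ) + (q ^ 2 + q + 1) - q * √q ≤ posetDim (PlaneJoin Pt Ln m) := by
  obtain ⟨p, -⟩ := ProjectivePlane.exists_config (P := Pt) (L := Ln)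
  have : Nonempty (PlaneJoin Pt Ln m) := ⟨bot (Sum.inl p)⟩
  exact le_posetDim fun d L hL => le_of_isRealizer_planeJoin hq hL

theorem card_planeJoin [Finite Pt] [Finite Ln] {q m : ℕ}
    (hq : q = ProjectivePlane.order Pt Ln) :
    Nat.card (PlaneJoin Pt Ln m) = 2 * (m + (q ^ 2 + q + 1)) := by
  have := Fintype.ofFinite Pt
  have := Fintype.ofFinite Ln
  rw [BipartitePoset.card_eq, Nat.card_sum, Nat.card_sum, Nat.card_fin, Nat.card_eq_fintype_card,
    Nat.card_eq_fintype_card, ProjectivePlane.card_points Pt Ln,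
    ProjectivePlane.card_lines Pt Ln, ← hq]
  ring

/-- Each incomparable pair of the copy lies wholly in the plane or wholly in `S_m`, since mixed
pairs are comparable. At most `m` lie in `S_m`; the others form an induced matching. -/
theorem le_of_planeJoin_containsStandardExample [Finite Pt] [Finite Ln] {q m d : ℕ}
    (hq : q = ProjectivePlane.order Pt Ln) (hd : 2 ≤ d)
    (h : ContainsStandardExample (PlaneJoin Pt Ln m) d) : (d : ℝ) ≤ m + q * √q + 1 := by
  classical
  obtain ⟨x, y, hxy⟩ := exists_pairs_of_containsStandardExample hd h
  have hself : ∀ i, ¬ planeJoinRel Pt Ln m (x i) (y i) := fun i hi => (hxy i i).1 hi rfl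
  have hx : Function.Injective x := by
    intro i j hij
    by_contra hne
    exact hself j (hij ▸ (hxy i j).2 hne)
  have hA : Fintype.card {i // (x i).isRight} ≤ m := by
    refine (Fintype.card_le_of_injective (fun i => (x i.1).getRight i.2) fun i j hij => ?_).trans
      (Fintype.card_fin m).le
    refine Subtype.ext (hx ?_)
    rw [← Sum.inr_getRight (x i.1) i.2, ← Sum.inr_getRight (x j.1) j.2]
    exact congrArg Sum.inr hij
  have hB : ∀ i : {i // ¬ (x i).isRight}, ∃ (p : Pt) (l : Ln),
      x i = Sum.inl p ∧ y i = Sum.inl l := by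
    rintro ⟨i, hi⟩
    have := hself i
    rcases hxi : x i with p | k
    · rcases hyi : y i with l | k
      · exact ⟨p, l, rfl, rfl⟩
      · rw [hxi, hyi] at this
        exact absurd trivial this
    · simp [hxi] at hi
  choose p l hp hl using hB
  have hC := card_le_of_induced_matching p l (fun i j => ?_) hq
  · have h1 := Fintype.card_subtype_compl (fun i : Fin d => (x i).isRight)
    rw [Fintype.card_fin] at h1
    have h2 : d ≤ m + Fintype.card {i // ¬ (x i).isRight} := by omega
    have h3 : (d : ℝ) ≤ m + Fintype.card {i // ¬ (x i).isRight} := by exact_mod_cast h2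
    linarith
  · have := hxy i j
    rw [hp, hl] at this
    rw [Subtype.ext_iff]
    exact not_iff_not.1 this

end Plane

/-! ### Planes of prime order and the growth of `f` -/

open scoped LinearAlgebra.Projectivization in
theorem order_projectivization_zmod (p : ℕ) [Fact p.Prime] :
    ProjectivePlane.order (ℙ (ZMod p) (Fin 3 → ZMod p)) (ℙ (ZMod p) (Fin 3 → ZMod p)) = p := by
  have := Fintype.ofFinite (ℙ (ZMod p) (Fin 3 → ZMod p))
  have h := ProjectivePlane.card_points (ℙ (ZMod p) (Fin 3 → ZMod p))
    (ℙ (ZMod p) (Fin 3 → ZMod p))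
  rw [← Nat.card_eq_fintype_card, Projectivization.card_of_finrank (n := 3) _ _ (by simp)] at h
  simp only [Finset.sum_range_succ, Finset.sum_range_zero, Nat.card_zmod] at h
  -- The number of points `q ^ 2 + q + 1` determines `q`.
  by_contra hne
  rcases lt_or_gt_of_ne hne with hlt | hlt <;> nlinarith

open scoped LinearAlgebra.Projectivization in
/-- A prime `q` with `q ^ (3 / 2) ≤ c` gives a quadratic lower bound on `f c`. -/
theorem ForcesStandardExamples.sq_le {f : ℕ → ℤ} (hf : ForcesStandardExamples f) {c q : ℕ}
    (hc : 1 ≤ c) (hq : q.Prime) (hqc : q * √q ≤ (c : ℝ)) : (q : ℝ) ^ 2 / 2 ≤ f c := by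
  have : Fact q.Prime := ⟨hq⟩
  have hord := (order_projectivization_zmod q).symm
  obtain ⟨n, hn, hge⟩ := ((hf c hc).and (eventually_ge_atTop (q ^ 2 + q + 1))).exists
  obtain ⟨m, rfl⟩ := Nat.exists_eq_add_of_le' hge
  have hdim := le_posetDim_planeJoin (m := m) hord
  obtain ⟨d, hd, hdf, hcon⟩ := hn
    (PlaneJoin (ℙ (ZMod q) (Fin 3 → ZMod q)) (ℙ (ZMod q) (Fin 3 → ZMod q)) m)
    (by rw [card_planeJoin hord]; omega)
    (by
      rw [← Int.cast_le (R := ℝ)]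
      push_cast
      linarith)
  have hle := le_of_planeJoin_containsStandardExample hord hd hcon
  rw [← Int.cast_le (R := ℝ)] at hdf
  push_cast at hdf
  have hq2 : (2 : ℝ) ≤ q := by exact_mod_cast hq.two_le
  have hrr : √(q : ℝ) ^ 2 = q := Real.sq_sqrt (by positivity)
  -- The gap is `q ^ 2 + q - q * √q`, and `q ^ 2 / 2 + q - q * √q = (q / 2) * ((√q - 1) ^ 2 + 1)`.
  nlinarith [sq_nonneg (√(q : ℝ) - 1)]

/-- A prime between a quarter of `c ^ (2 / 3)` and `c ^ (2 / 3)`. -/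
theorem exists_prime_near_rpow_two_thirds {c : ℕ} (hc : 8 ≤ c) :
    ∃ q : ℕ, q.Prime ∧ q * √q ≤ (c : ℝ) ∧ (c : ℝ) ^ (2 / 3 : ℝ) ≤ 4 * q := by
  set x : ℝ := (c : ℝ) ^ (2 / 3 : ℝ) with hx
  have hc0 : (0 : ℝ) ≤ c := by positivity
  have hx0 : 0 ≤ x := by positivity
  have hx4 : 4 ≤ x := by
    calc (4 : ℝ) = (8 : ℝ) ^ (2 / 3 : ℝ) := by
          rw [show (8 : ℝ) = 2 ^ (3 : ℝ) by norm_num, ← Real.rpow_mul (by norm_num)]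
          norm_num
      _ ≤ x := Real.rpow_le_rpow (by norm_num) (by exact_mod_cast hc) (by norm_num)
  have hfloor : 2 ≤ ⌊x / 2⌋₊ := Nat.le_floor (by push_cast; linarith)
  -- Bertrand's postulate at half of `c ^ (2 / 3)`.
  obtain ⟨q, hq, hlt, hle⟩ := Nat.exists_prime_lt_and_le_two_mul ⌊x / 2⌋₊ (by omega)
  have hqx : (q : ℝ) ≤ x := by
    have h1 : (q : ℝ) ≤ 2 * ⌊x / 2⌋₊ := by exact_mod_cast hle
    have h2 := Nat.floor_le (show 0 ≤ x / 2 by positivity)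
    linarith
  refine ⟨q, hq, ?_, ?_⟩
  · rw [← rpow_three_halves_eq]
    calc (q : ℝ) ^ (3 / 2 : ℝ) ≤ x ^ (3 / 2 : ℝ) :=
          Real.rpow_le_rpow (by positivity) hqx (by norm_num)
      _ = c := by rw [hx, ← Real.rpow_mul hc0]; norm_num
  · have h1 : (⌊x / 2⌋₊ : ℝ) + 1 ≤ q := by exact_mod_cast hlt
    have h2 := Nat.lt_floor_add_one (x / 2)
    linarith

theorem mainTheorem4 :
    (∃ C : ℝ, 0 < C ∧ ∃ c₀ : ℕ, ∀ f : ℕ → ℤ, ForcesStandardExamples f →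
      ∀ c : ℕ, c₀ ≤ c → C * (c : ℝ) ^ (4 / 3 : ℝ) ≤ (f c : ℝ)) ∧
    (∀ (Pt : Type*) (Ln : Type*) [Membership Pt Ln] [Configuration.ProjectivePlane Pt Ln]
      [Finite Pt] [Finite Ln] (q m n : ℕ),
      q = Configuration.ProjectivePlane.order Pt Ln →
      n = m + (q ^ 2 + q + 1) →
      Nat.card (PlaneJoin Pt Ln m) = 2 * n ∧
      (n : ℝ) - (q : ℝ) ^ (3 / 2 : ℝ) ≤ (posetDim (PlaneJoin Pt Ln m) : ℝ) ∧
      ∀ d : ℕ, (m : ℝ) + (q : ℝ) ^ (3 / 2 : ℝ) + 2 ≤ (d : ℝ) →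
        ¬ ContainsStandardExample (PlaneJoin Pt Ln m) d) := by
  -- `1 / 32` comes from `q ^ 2 / 2` with `q ≥ c ^ (2 / 3) / 4`.
  refine ⟨⟨1 / 32, by norm_num, 8, fun f hf c hc => ?_⟩, ?_⟩
  · obtain ⟨q, hq, hqc, hcq⟩ := exists_prime_near_rpow_two_thirds hc
    have h1 := hf.sq_le (by omega) hq hqc
    have h2 : (c : ℝ) ^ (4 / 3 : ℝ) = ((c : ℝ) ^ (2 / 3 : ℝ)) ^ 2 := by
      rw [← Real.rpow_natCast, ← Real.rpow_mul (by positivity)]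
      norm_num
    have h3 : ((c : ℝ) ^ (2 / 3 : ℝ)) ^ 2 ≤ (4 * q) ^ 2 :=
      pow_le_pow_left₀ (by positivity) hcq 2
    rw [h2]
    linarith
  · rintro Pt Ln _ _ _ _ q m n hq rfl
    rw [rpow_three_halves_eq]
    refine ⟨card_planeJoin hq, ?_, fun d hd hcon => ?_⟩
    · push_cast
      exact le_posetDim_planeJoin hq
    · have h0 : 0 ≤ (q : ℝ) * √q := by positivity
      have hd2 : (2 : ℝ) ≤ d := by
        have : (0 : ℝ) ≤ m := by positivity
        linarith
      have := le_of_planeJoin_containsStandardExample hq (by exact_mod_cast hd2) hcon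
      linarith
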